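/- Let $\varphi(q)=\sum_{k\in\mathbb{Z}}q^{k^2}$ and put $$F(q)=\sum_{n\ge 0}ph_3(n)q^n:=\frac{\varphi(-q^3)}{\varphi(-q)},\qquad \xi=\xi(q):=\frac{\varphi(-q^9)}{\varphi(-q)},$$ as formal power series with integer coefficients. Let $\nu(n)$ denote the $3$-adic valuation of an integer $n$, with $\nu(0)=\infty$. For $m\ge 1$ define $$\widehat{\Phi}_m:=\frac{1}{F(q^3)}\sum_{n\ge 0}\left(ph_3\big(3^{2m+1}n\big)-ph_3\big(3^{2m-1}n\big)\right)q^n .$$ Then for every $m\ge 1$ we have $\widehat{\Phi}_m\in\mathbb{Z}[\xi]$. Furthermore, if we write $\widehat{\Phi}_m=\sum_k C_m(k)\xi^k$ (a finite sum with $C_m(k)\in\mathbb{Z}$), then for every $k\ge 0$, $$\nu\big(C_m(k)\big)\ge m+2+\left\lfloor\frac{k}{2}\right\rfloor .$$ Consequently, for all $m\ge 1$ and $n\ge 0$, $$ph_3\big(3^{2m+1}n\big)\equiv ph_3\big(3^{2m-1}n\big)\pmod{3^{m+2}} .$$ -/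

import Mathlib

namespace InternalCongruence

/-- Ramanujan's theta function `φ(q) = ∑_{k ∈ ℤ} q^(k^2)`, as a formal power series in `q`:
its `n`-th coefficient is the number of integers `k` with `k^2 = n`. -/
noncomputable def phi : PowerSeries ℤ :=
  PowerSeries.mk fun n => (({k : ℤ | k ^ 2 = (n : ℤ)}.ncard : ℕ) : ℤ)

/-- The series `φ(-q)`. -/
noncomputable def phiNeg : PowerSeries ℤ :=
  PowerSeries.rescale (-1 : ℤ) phi

/-- The substitution `q ↦ q^d` (for `d ≠ 0`) in a formal power series. -/
noncomputable def atPow (d : ℕ) [NeZero d] (f : PowerSeries ℤ) : PowerSeries ℤ :=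
  PowerSeries.expand d (NeZero.ne d) f

/-- The quotient `f / g` of two integral power series, for `g` with constant term `1`
(the only case in which it is used). -/
noncomputable def quot (f g : PowerSeries ℤ) : PowerSeries ℤ :=
  f * PowerSeries.invOfUnit g 1

/-- `F(q) = φ(-q^3) / φ(-q)`. -/
noncomputable def F : PowerSeries ℤ :=
  quot (atPow 3 phiNeg) phiNeg

/-- `ph_3(n)`, the coefficient of `q^n` in `φ(-q^3) / φ(-q)`. -/
noncomputable def ph3 (n : ℕ) : ℤ :=
  PowerSeries.coeff n F

/-- `ξ(q) = φ(-q^9) / φ(-q)`. -/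
noncomputable def xi : PowerSeries ℤ :=
  quot (atPow 9 phiNeg) phiNeg

/-- `(1 / F(q^3)) * ∑_{n ≥ 0} (ph_3(3^(2m+1) n) - ph_3(3^(2m-1) n)) q^n`, for `m ≥ 1`. -/
noncomputable def PhiHat (m : ℕ) : PowerSeries ℤ :=
  quot (PowerSeries.mk fun n => ph3 (3 ^ (2 * m + 1) * n) - ph3 (3 ^ (2 * m - 1) * n))
    (atPow 3 F)

/-- The `3`-adic valuation of an integer, with the value `∞` at `0`. -/
noncomputable def nu (n : ℤ) : ℕ∞ :=
  emultiplicity 3 n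

/-! The quotients above are genuine: every denominator has constant term `1`. -/

theorem quot_mul_cancel (f g : PowerSeries ℤ) (hg : PowerSeries.constantCoeff g = 1) :
    quot f g * g = f := by
  have h : g * PowerSeries.invOfUnit g 1 = 1 := PowerSeries.mul_invOfUnit g 1 (by simpa using hg)
  rw [quot, mul_assoc, mul_comm (PowerSeries.invOfUnit g 1) g, h, mul_one]

theorem constantCoeff_atPow (d : ℕ) [NeZero d] (f : PowerSeries ℤ) :
    PowerSeries.constantCoeff (atPow d f) = PowerSeries.constantCoeff f := by
  rw [atPow, PowerSeries.expand_apply, PowerSeries.constantCoeff_subst_X_pow (NeZero.ne d)]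
  rfl

theorem constantCoeff_phiNeg : PowerSeries.constantCoeff phiNeg = 1 := by
  rw [← PowerSeries.coeff_zero_eq_constantCoeff_apply, phiNeg, PowerSeries.coeff_rescale, phi,
    PowerSeries.coeff_mk]
  simp

theorem constantCoeff_F : PowerSeries.constantCoeff F = 1 := by
  simp [F, quot, constantCoeff_atPow, constantCoeff_phiNeg]

end InternalCongruence

/-! Write `U` for the extraction of the coefficients at multiples of `3`, and `p = 3X² - 3X + 1`.
Two relations drive everything: `ξ = F(q) F(q³)`, and a theta identity equivalent to `ξ³ = F(q³)⁴
p(ξ)`. The second gives a three-term recurrence for the powers of `ξ` over series in `q³`, so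
`U(ξᵏ)` is an explicit integer polynomial in `F⁴`. Since `F³ = F(q³) p(ξ)` and `F⁴ = ξ p(ξ)`, the
operator `U²` maps `F(q³) P(ξ)` to `F(q³) (T P)(ξ)`, where `T` is `transfer`
(`huff_huff_atPow_F_mul`). As `U F = F³`, the series `PhiHat (i + 1)` is `(Tⁱ⁺¹ p - Tⁱ p)(ξ)`.

The valuation bound is an induction on `i`. The base case is `transfer_cubicPoly_sub_mem`. In the
inductive step `T` gains one power of `3` (`transfer_mem`), but only on polynomials vanishing at
`1`: already `T 1 = p` gains nothing. The differences do vanish there, because `U` preserves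
constant terms and `ξ` has constant term `1` (`eval_one_transfer`). Finally, `ξ` is transcendental,
so the bound holds for every polynomial representing the series. -/

namespace InternalCongruence

/-! ### Polynomials in `ξ` and their 3-adic estimates -/

open Polynomial

/-- The linear endomorphism of `ℤ[X]` sending `X ^ k` to `f k`. -/
noncomputable def monomialLift (f : ℕ → ℤ[X]) : ℤ[X] →ₗ[ℤ] ℤ[X] :=
  Polynomial.lsum fun k => LinearMap.toSpanSingleton ℤ ℤ[X] (f k)

theorem monomialLift_eq_sum (f : ℕ → ℤ[X]) (P : ℤ[X]) :
    monomialLift f P = P.sum fun k c => c • f k := by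
  simp [monomialLift, Polynomial.lsum_apply]

theorem monomialLift_X_pow (f : ℕ → ℤ[X]) (k : ℕ) : monomialLift f (X ^ k) = f k := by
  rw [monomialLift_eq_sum, X_pow_eq_monomial, sum_monomial_index _ _ (by simp), one_smul]

theorem monomialLift_X (f : ℕ → ℤ[X]) : monomialLift f X = f 1 := by
  rw [← monomialLift_X_pow f 1, pow_one]

theorem monomialLift_one (f : ℕ → ℤ[X]) : monomialLift f 1 = f 0 := by
  rw [← monomialLift_X_pow f 0, pow_zero]

/-- The polynomials `u k` with `U (ξ ^ k) = u k (F ^ 4)`, where `U` extracts the coefficients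
at multiples of `3`. -/
noncomputable def huffPoly : ℕ → ℤ[X]
  | 0 => 1
  | 1 => X
  | 2 => 3 * X ^ 2 - 2 * X
  | k + 3 => X * (3 * huffPoly (k + 2) - 3 * huffPoly (k + 1) + huffPoly k)

theorem coeff_zero_huffPoly (k : ℕ) : (huffPoly (k + 1)).coeff 0 = 0 := by
  match k with
  | 0 => simp [huffPoly]
  | 1 => simp [huffPoly]
  | k + 2 => rw [huffPoly, mul_comm, mul_coeff_zero]; simp

theorem coeff_succ_huffPoly (k j : ℕ) : (huffPoly (k + 3)).coeff (j + 1) =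
    3 * (huffPoly (k + 2)).coeff j - 3 * (huffPoly (k + 1)).coeff j + (huffPoly k).coeff j := by
  rw [huffPoly, coeff_X_mul, coeff_add, coeff_sub]
  have h : ∀ q : ℤ[X], (3 * q).coeff j = 3 * q.coeff j := fun q => by
    rw [show (3 : ℤ[X]) = C 3 from rfl, coeff_C_mul]
  rw [h, h]

theorem coeff_huffPoly_two (j : ℕ) :
    (huffPoly 2).coeff j = if j = 2 then 3 else if j = 1 then -2 else 0 := by
  rw [huffPoly, show (3 : ℤ[X]) = C 3 from rfl, show (2 : ℤ[X]) = C 2 from rfl, coeff_sub,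
    coeff_C_mul, coeff_C_mul, coeff_X_pow, coeff_X]
  split_ifs <;> omega

/-- Three steps in the index cost one factor `X`. In particular `X ^ (j + 1)` divides `huffPoly (4 *
j + 1)`, which makes `huffQuot` an exact quotient. -/
theorem coeff_huffPoly_eq_zero (k j : ℕ) (h : 3 * j < k) : (huffPoly k).coeff j = 0 := by
  induction k using Nat.strong_induction_on generalizing j with
  | _ k ih =>
    match k, j with
    | 0, j => omega
    | k + 1, 0 => exact coeff_zero_huffPoly k
    | 1, j + 1 => omega
    | 2, j + 1 => omega
    | k + 3, j + 1 =>
      rw [coeff_succ_huffPoly, ih _ (by omega) _ (by omega), ih _ (by omega) _ (by omega),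
        ih _ (by omega) _ (by omega)]
      simp

theorem coeff_huffPoly_three_mul (j : ℕ) : (huffPoly (3 * j)).coeff j = 1 := by
  induction j with
  | zero => simp [huffPoly]
  | succ j ih =>
    rw [show 3 * (j + 1) = 3 * j + 3 by ring, coeff_succ_huffPoly, ih,
      coeff_huffPoly_eq_zero _ _ (by omega), coeff_huffPoly_eq_zero _ _ (by omega)]
    simp

/-- In the recurrence, raising the degree by one while advancing the index by only one or two costs
a factor `3`; advancing it by three is free. The subtraction is truncated, so the bound is vacuous
when `3 * j ≤ k + 2`. -/
theorem pow_dvd_coeff_huffPoly (k j : ℕ) :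
    (3 : ℤ) ^ ((3 * j - k - 1) / 2) ∣ (huffPoly k).coeff j := by
  induction k using Nat.strong_induction_on generalizing j with
  | _ k ih =>
    match k, j with
    | 0, 0 => simp
    | 0, j + 1 => simp [huffPoly, coeff_one]
    | k + 1, 0 => rw [coeff_zero_huffPoly]; exact dvd_zero _
    | 1, j + 1 => rcases j with _ | j <;> simp [huffPoly, coeff_X]
    | 2, j + 1 => rcases j with _ | _ | j <;> simp [coeff_huffPoly_two]
    | k + 3, j + 1 =>
      rw [coeff_succ_huffPoly]
      have h3 : ∀ {e d : ℕ} {c : ℤ}, (3 : ℤ) ^ e ∣ c → d ≤ e + 1 → (3 : ℤ) ^ d ∣ 3 * c := by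
        intro e d c hc hd
        refine (pow_dvd_pow 3 hd).trans ?_
        rw [pow_succ']
        exact mul_dvd_mul_left 3 hc
      refine dvd_add (dvd_sub (h3 (ih _ (by omega) _) (by omega)) (h3 (ih _ (by omega) _) ?_))
        ((pow_dvd_pow 3 ?_).trans (ih _ (by omega) _))
      all_goals omega

/-- `v j = u (4 j + 1) / X ^ (j + 1)`, so that `U (F ^ (4 j + 1)) = F ^ 3 * v j (F ^ 4)`. -/
noncomputable def huffQuot (j : ℕ) : ℤ[X] :=
  divX^[j + 1] (huffPoly (4 * j + 1))

theorem coeff_iterate_divX (P : ℤ[X]) (i r : ℕ) : (divX^[i] P).coeff r = P.coeff (r + i) := by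
  induction i generalizing r with
  | zero => rfl
  | succ i ih => rw [Function.iterate_succ_apply', coeff_divX, ih, add_right_comm, add_assoc]

theorem coeff_huffQuot (j r : ℕ) :
    (huffQuot j).coeff r = (huffPoly (4 * j + 1)).coeff (r + (j + 1)) :=
  coeff_iterate_divX _ _ _

theorem X_pow_mul_huffQuot (j : ℕ) : X ^ (j + 1) * huffQuot j = huffPoly (4 * j + 1) := by
  ext i
  rw [coeff_X_pow_mul']
  split_ifs with h
  · rw [coeff_huffQuot, Nat.sub_add_cancel h]
  · rw [coeff_huffPoly_eq_zero _ _ (by omega)]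

theorem huffQuot_zero : huffQuot 0 = 1 := by
  simpa [huffQuot, huffPoly] using divX_X_pow (R := ℤ) (n := 1)

/-- The polynomials whose `k`-th coefficient is divisible by `3 ^ (s + ⌊k / 2⌋)`. -/
noncomputable def valuationFilt (s : ℕ) : Submodule ℤ ℤ[X] where
  carrier := {P | ∀ k, (3 : ℤ) ^ (s + k / 2) ∣ P.coeff k}
  add_mem' hP hQ k := by rw [coeff_add]; exact dvd_add (hP k) (hQ k)
  zero_mem' k := by simp
  smul_mem' c P hP k := by rw [coeff_smul, smul_eq_mul]; exact (hP k).mul_left c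

theorem smul_mem_valuationFilt {s : ℕ} {P : ℤ[X]} (hP : P ∈ valuationFilt s) {t : ℕ} {c : ℤ}
    (hc : (3 : ℤ) ^ t ∣ c) : c • P ∈ valuationFilt (t + s) := by
  intro k
  rw [coeff_smul, smul_eq_mul, add_assoc, pow_add]
  exact mul_dvd_mul hc (hP k)

/-- `F ^ 3 = F(q ^ 3) * p(ξ)` and `F ^ 4 = ξ * p(ξ)` for this polynomial `p`. -/
noncomputable def cubicPoly : ℤ[X] := 3 * X ^ 2 - 3 * X + 1

theorem coeff_cubicPoly (k : ℕ) : cubicPoly.coeff k =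
    if k = 0 then 1 else if k = 1 then -3 else if k = 2 then 3 else 0 := by
  rw [cubicPoly, show (3 : ℤ[X]) = C 3 from rfl, coeff_add, coeff_sub,
    coeff_C_mul, coeff_C_mul, coeff_X_pow, coeff_X, coeff_one]
  split_ifs <;> omega

theorem pow_dvd_coeff_cubicPoly_pow (n k : ℕ) :
    (3 : ℤ) ^ ((k + 1) / 2) ∣ (cubicPoly ^ n).coeff k := by
  induction n generalizing k with
  | zero =>
    rw [pow_zero, coeff_one]
    split_ifs with h
    · simp [h]
    · exact dvd_zero _
  | succ n ih =>
    rw [pow_succ, coeff_mul]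
    refine Finset.dvd_sum fun x hx => ?_
    have hx' : x.1 + x.2 = k := by simpa using hx
    have h2 : (3 : ℤ) ^ ((x.2 + 1) / 2) ∣ cubicPoly.coeff x.2 := by
      rw [coeff_cubicPoly]
      split_ifs with h h h <;> simp [h]
    refine (pow_dvd_pow 3 ?_).trans ((pow_add (3 : ℤ) _ _).symm ▸ mul_dvd_mul (ih x.1) h2)
    omega

theorem cubicPoly_mul_pow_mem (r : ℕ) (s : ℕ) (c : ℤ) (hc : (3 : ℤ) ^ (s + r / 2) ∣ c) :
    c • (cubicPoly * (X * cubicPoly) ^ r) ∈ valuationFilt s := by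
  intro l
  rw [mul_pow, mul_left_comm, ← pow_succ', coeff_smul, coeff_X_pow_mul', smul_eq_mul]
  split_ifs with h
  · refine (pow_dvd_pow 3 ?_).trans ((pow_add (3 : ℤ) _ _).symm ▸
      mul_dvd_mul hc (pow_dvd_coeff_cubicPoly_pow (r + 1) (l - r)))
    omega
  · simp

/-- The term `X ^ r` becomes `X ^ r * cubicPoly ^ (r + 1)`, and the coefficient of `X ^ i` in a
power of `cubicPoly` is divisible by `3 ^ ⌈i / 2⌉`, enough since `⌊r / 2⌋ + ⌈i / 2⌉ ≥ ⌊(r + i) /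
2⌋`. -/
theorem cubicPoly_mul_comp_mem {s : ℕ} {P : ℤ[X]} (hP : P ∈ valuationFilt s) :
    cubicPoly * P.comp (X * cubicPoly) ∈ valuationFilt s := by
  rw [comp, eval₂_eq_sum, Polynomial.sum, Finset.mul_sum]
  refine Submodule.sum_mem _ fun r _ => ?_
  have := cubicPoly_mul_pow_mem r s _ (hP r)
  rwa [smul_eq_C_mul, mul_left_comm] at this

/-- The linear map sending `X ^ k` to `∑ j, (u k).coeff j * v j`. -/
noncomputable def preTransfer : ℤ[X] →ₗ[ℤ] ℤ[X] :=
  monomialLift fun k => monomialLift huffQuot (huffPoly k)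

/-- The operator on `ℤ[X]` corresponding, via `P ↦ F(q ^ 3) * P(ξ)`, to the extraction of the
coefficients at multiples of `9`. -/
noncomputable def transfer (P : ℤ[X]) : ℤ[X] :=
  cubicPoly * (preTransfer P).comp (X * cubicPoly)

theorem transfer_sub (P Q : ℤ[X]) : transfer (P - Q) = transfer P - transfer Q := by
  rw [transfer, transfer, transfer, map_sub, sub_comp, mul_sub]

theorem preTransfer_eq (P : ℤ[X]) :
    preTransfer P = monomialLift huffQuot (monomialLift huffPoly P) := by
  rw [preTransfer, monomialLift_eq_sum, monomialLift_eq_sum huffPoly, Polynomial.sum,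
    Polynomial.sum, map_sum]
  simp only [map_smul]

theorem preTransfer_one : preTransfer 1 = 1 := by
  rw [preTransfer, monomialLift_one, huffPoly, monomialLift_one, huffQuot_zero]

theorem preTransfer_X : preTransfer X = huffQuot 1 := by
  rw [preTransfer, monomialLift_X, huffPoly, monomialLift_X]

theorem preTransfer_X_sq : preTransfer (X ^ 2) = (3 : ℤ) • huffQuot 2 - (2 : ℤ) • huffQuot 1 := by
  rw [preTransfer, monomialLift_X_pow, huffPoly,
    show (3 * X ^ 2 - 2 * X : ℤ[X]) = (3 : ℤ) • X ^ 2 - (2 : ℤ) • X by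
      simp [smul_eq_C_mul], map_sub, map_smul, map_smul, monomialLift_X_pow, monomialLift_X]

theorem huffQuot_sub_one_mem {j : ℕ} (h1 : 1 ≤ j) (h2 : j ≤ 2)
    (h : (3 : ℤ) ∣ (huffPoly (4 * j + 1)).coeff (j + 1) - 1) :
    huffQuot j - 1 ∈ valuationFilt 1 := by
  intro r
  rw [coeff_sub, coeff_huffQuot, coeff_one]
  rcases r with _ | r
  · simpa using h
  · simp only [Nat.add_eq_zero_iff, one_ne_zero, and_false, if_false, sub_zero]
    refine (pow_dvd_pow 3 ?_).trans (pow_dvd_coeff_huffPoly _ _)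
    -- This needs `j ≤ 2`: for `j = 3` the general bound gives nothing at the coefficient of `X`.
    omega

theorem huffQuot_one_sub_one_mem : huffQuot 1 - 1 ∈ valuationFilt 1 := by
  refine huffQuot_sub_one_mem le_rfl one_le_two ?_
  have h : (huffPoly 3).coeff 1 = 1 := coeff_huffPoly_three_mul 1
  -- Modulo `3` only the last term of the recurrence survives, and it is `-2 ≡ 1`.
  rw [show 4 * 1 + 1 = 2 + 3 from rfl, coeff_succ_huffPoly, coeff_huffPoly_two, h]
  norm_num
  exact ⟨-(2 : ℤ) + (huffPoly 4).coeff 1, by ring⟩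

theorem huffQuot_two_sub_one_mem : huffQuot 2 - 1 ∈ valuationFilt 1 := by
  refine huffQuot_sub_one_mem one_le_two le_rfl ?_
  rw [show 4 * 2 + 1 = 3 * (2 + 1) from rfl, coeff_huffPoly_three_mul]
  simp

theorem pow_smul_preTransfer_X_pow_mem {k : ℕ} (hk : 2 ≤ k) :
    (3 : ℤ) ^ (k / 2) • preTransfer (X ^ k) ∈ valuationFilt 1 := by
  rw [preTransfer, monomialLift_X_pow, monomialLift_eq_sum, Polynomial.sum, Finset.smul_sum]
  refine Submodule.sum_mem _ fun j hj => ?_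
  have hkj : k ≤ 3 * j := by
    by_contra h
    exact mem_support_iff.mp hj (coeff_huffPoly_eq_zero k j (by omega))
  intro r
  rw [coeff_smul, coeff_smul, smul_eq_mul, smul_eq_mul, coeff_huffQuot]
  refine (pow_dvd_pow 3 ?_).trans (((pow_add (3 : ℤ) _ _).trans (congrArg _ (pow_add (3 : ℤ) _ _)))
    ▸ mul_dvd_mul dvd_rfl (mul_dvd_mul (pow_dvd_coeff_huffPoly k j)
      (pow_dvd_coeff_huffPoly (4 * j + 1) (r + (j + 1)))))
  -- Passing to `huffQuot j` loses about `j / 2`; the factors `3 ^ (k / 2)` and `(huffPoly k).coeff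
  -- j` together supply about `3 * j / 2`.
  omega

theorem pow_smul_preTransfer_X_pow_sub_one_mem (k : ℕ) :
    (3 : ℤ) ^ (k / 2) • (preTransfer (X ^ k) - 1) ∈ valuationFilt 1 := by
  match k with
  | 0 => simp [preTransfer_one]
  | 1 => simpa [preTransfer_X] using huffQuot_one_sub_one_mem
  | k + 2 =>
    rw [smul_sub]
    refine Submodule.sub_mem _ (pow_smul_preTransfer_X_pow_mem (by omega)) fun r => ?_
    rw [coeff_smul, coeff_one, smul_eq_mul]
    split_ifs with h
    · subst h
      simp
    · simp

/-- Since the coefficients of `P` sum to zero, each `preTransfer (X ^ k)` may be replaced by its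
difference from `1`, which supplies the extra factor `3`. -/
theorem transfer_mem {s : ℕ} {P : ℤ[X]} (hP : P ∈ valuationFilt s) (h1 : P.eval 1 = 0) :
    transfer P ∈ valuationFilt (s + 1) := by
  refine cubicPoly_mul_comp_mem ?_
  have key : preTransfer P = P.sum fun k c => c • (preTransfer (X ^ k) - 1) := by
    rw [eval_eq_sum] at h1
    simp only [one_pow, mul_one] at h1
    simp only [smul_sub, Polynomial.sum] at h1 ⊢
    rw [Finset.sum_sub_distrib, ← Finset.sum_smul, h1, zero_smul, sub_zero, preTransfer,
      monomialLift_eq_sum]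
    simp only [monomialLift_X_pow, Polynomial.sum]
  rw [key]
  refine Submodule.sum_mem _ fun k _ => ?_
  obtain ⟨c, hc⟩ := hP k
  simp only [hc]
  rw [pow_add, mul_right_comm, mul_smul]
  exact smul_mem_valuationFilt (pow_smul_preTransfer_X_pow_sub_one_mem k) (dvd_mul_right _ _)

theorem transfer_cubicPoly_sub_mem : transfer cubicPoly - cubicPoly ∈ valuationFilt 3 := by
  -- With `v = huffQuot`, this is `3 (3 v₂ - 2 v₁) - 3 v₁ + 1`; the `9` gives two powers of `3`, and
  -- `v₂ - v₁` a third.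
  have h : preTransfer cubicPoly =
      (9 : ℤ) • ((huffQuot 2 - 1) - (huffQuot 1 - 1)) + 1 := by
    rw [show cubicPoly = (3 : ℤ) • X ^ 2 - (3 : ℤ) • X + 1 by simp [cubicPoly, smul_eq_C_mul],
      map_add, map_sub, map_smul, map_smul, preTransfer_one, preTransfer_X, preTransfer_X_sq]
    module
  have h' : transfer cubicPoly - cubicPoly =
      cubicPoly * ((9 : ℤ) • ((huffQuot 2 - 1) - (huffQuot 1 - 1))).comp (X * cubicPoly) := by
    rw [transfer, h, add_comp, one_comp]
    ring
  rw [h']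
  exact cubicPoly_mul_comp_mem (smul_mem_valuationFilt (t := 2)
    (Submodule.sub_mem _ huffQuot_two_sub_one_mem huffQuot_one_sub_one_mem) (by norm_num))

end InternalCongruence

/-! ### The theta function: dissection modulo 3, Gauss' product, and the quartic identity -/

namespace InternalCongruence

open PowerSeries

theorem coeff_atPow_mul (d : ℕ) [NeZero d] (f : ℤ⟦X⟧) (n : ℕ) :
    coeff (d * n) (atPow d f) = coeff n f := by
  rw [atPow, coeff_expand_mul]

theorem coeff_atPow_of_not_dvd (d : ℕ) [NeZero d] (f : ℤ⟦X⟧) {n : ℕ} (h : ¬ d ∣ n) :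
    coeff n (atPow d f) = 0 := by
  rw [atPow, coeff_expand_of_not_dvd _ _ _ h]

theorem ncard_sq_eq (n : ℕ) : {k : ℤ | k ^ 2 = (n : ℤ)}.ncard =
    if n = 0 then 1 else if IsSquare n then 2 else 0 := by
  split_ifs with h0 hs
  · simp [h0]
  · obtain ⟨r, rfl⟩ := hs
    have hr : r ≠ 0 := by rintro rfl; simp at h0
    have : {k : ℤ | k ^ 2 = ((r * r : ℕ) : ℤ)} = {(r : ℤ), -(r : ℤ)} := by
      ext k
      simp only [Set.mem_ofPred_eq, Set.mem_insert_iff, Set.mem_singleton_iff]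
      rw [Nat.cast_mul, ← sq, sq_eq_sq_iff_eq_or_eq_neg]
    rw [this, Set.ncard_pair]
    omega
  · have : {k : ℤ | k ^ 2 = (n : ℤ)} = ∅ := by
      ext k
      simp only [Set.mem_ofPred_eq, Set.mem_empty_iff_false, iff_false]
      intro hk
      refine hs ⟨k.natAbs, ?_⟩
      zify
      rw [← hk, ← sq, sq_abs]
    rw [this, Set.ncard_empty]

theorem coeff_phiNeg (n : ℕ) : coeff n phiNeg =
    (-1) ^ n * if n = 0 then 1 else if IsSquare n then 2 else 0 := by
  rw [phiNeg, coeff_rescale, phi, coeff_mk, ncard_sq_eq]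
  push_cast
  rfl

theorem isSquare_mul_self_mul_iff {d n : ℕ} (hd : d ≠ 0) : IsSquare (d * d * n) ↔ IsSquare n := by
  constructor
  · rintro ⟨r, hr⟩
    obtain ⟨s, rfl⟩ : d ∣ r := by
      rw [← Nat.pow_dvd_pow_iff two_ne_zero, sq, sq, ← hr]
      exact dvd_mul_right _ _
    refine ⟨s, Nat.eq_of_mul_eq_mul_left (Nat.pos_of_ne_zero (mul_ne_zero hd hd)) ?_⟩
    rw [hr]
    ring
  · exact fun h => (IsSquare.mul_self d).mul h

/-- The components of `φ(-q)` at exponents divisible by `3` form `φ(-q ^ 9)`, and those at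
exponents `2` modulo `3` vanish. -/
theorem coeff_phiNeg_sub_atPow (n : ℕ) (hn : n % 3 ≠ 1) :
    coeff n (phiNeg - atPow 9 phiNeg) = 0 := by
  rw [map_sub, sub_eq_zero]
  by_cases h9 : 9 ∣ n
  · obtain ⟨m, rfl⟩ := h9
    have hs := isSquare_mul_self_mul_iff (d := 3) (n := m) (by norm_num)
    norm_num at hs
    have h1 : (-1 : ℤ) ^ (9 * m) = (-1) ^ m := by rw [pow_mul]; norm_num
    rw [coeff_atPow_mul, coeff_phiNeg, coeff_phiNeg, h1]
    simp [hs]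
  · rw [coeff_atPow_of_not_dvd 9 _ h9, coeff_phiNeg, if_neg (by rintro rfl; simp at h9), if_neg,
      mul_zero]
    rintro ⟨r, rfl⟩
    rcases (by omega : r % 3 = 0 ∨ r % 3 = 1 ∨ r % 3 = 2) with h | h | h
    · exact h9 (mul_dvd_mul (a := 3) (c := 3) (Nat.dvd_of_mod_eq_zero h) (Nat.dvd_of_mod_eq_zero h))
    · simp [Nat.mul_mod, h] at hn
    · simp [Nat.mul_mod, h] at hn

section GaussProduct

variable {K : Type*} [Field K]

/-- The factor `(1 - q ^ n) / (1 + q ^ n)` of the product for `φ(-q)`. -/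
noncomputable def gaussFactor (K : Type*) [Field K] (n : ℕ) : K⟦X⟧ :=
  (1 - X ^ n) * (1 + X ^ n)⁻¹

/-- The partial product `∏_{1 ≤ i ≤ n} (1 - q ^ i) / (1 + q ^ i)`. -/
noncomputable def gaussProd (K : Type*) [Field K] (n : ℕ) : K⟦X⟧ :=
  ∏ i ∈ Finset.range n, gaussFactor K (i + 1)

theorem gaussProd_succ (n : ℕ) :
    gaussProd K (n + 1) = gaussProd K n * gaussFactor K (n + 1) :=
  Finset.prod_range_succ _ _

theorem one_add_X_pow_mul_inv {n : ℕ} (hn : n ≠ 0) :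
    (1 + X ^ n : K⟦X⟧) * (1 + X ^ n)⁻¹ = 1 :=
  PowerSeries.mul_inv_cancel _ (by simp [hn])

theorem one_sub_X_pow_mul_inv {n : ℕ} (hn : n ≠ 0) :
    (1 - X ^ n : K⟦X⟧) * (1 - X ^ n)⁻¹ = 1 :=
  PowerSeries.mul_inv_cancel _ (by simp [hn])

theorem gaussFactor_mul {n : ℕ} (hn : n ≠ 0) :
    gaussFactor K n * (1 + X ^ n) = 1 - X ^ n := by
  rw [gaussFactor, mul_assoc, mul_comm _ (1 + X ^ n), one_add_X_pow_mul_inv hn, mul_one]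

/-- The coefficients `(-1) ^ s (-1; q)_s / (q; q)_s` of Shanks' finite form of Gauss' identity. -/
noncomputable def shanksCoeff (K : Type*) [Field K] : ℕ → K⟦X⟧
  | 0 => 1
  | s + 1 => -(shanksCoeff K s * (1 + X ^ s)) * (1 - X ^ (s + 1))⁻¹

theorem shanksCoeff_succ_mul (s : ℕ) :
    shanksCoeff K (s + 1) * (1 - X ^ (s + 1)) = -(shanksCoeff K s * (1 + X ^ s)) := by
  rw [shanksCoeff, mul_assoc, mul_comm _ (1 - X ^ (s + 1)), one_sub_X_pow_mul_inv s.succ_ne_zero,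
    mul_one]

/-- Evaluates the boundary term of the telescoping sum, which becomes the new theta term `2 (-1)ⁿ
q^(n²)`. -/
theorem gaussProd_mul_shanksCoeff (n : ℕ) :
    gaussProd K n * (1 + X ^ n) * shanksCoeff K n = 2 * (-1) ^ n := by
  induction n with
  | zero => simp [gaussProd, shanksCoeff]; norm_num
  | succ n ih =>
    have h1 := gaussFactor_mul (K := K) n.succ_ne_zero
    have h2 := shanksCoeff_succ_mul (K := K) n
    rw [gaussProd_succ, pow_succ]
    rw [Nat.succ_eq_add_one] at h1
    linear_combination gaussProd K n * shanksCoeff K (n + 1) * h1 + gaussProd K n * h2 - ih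

theorem shanks_telescope (n m : ℕ) :
    ∑ s ∈ Finset.range m,
      shanksCoeff K s * (X ^ n) ^ s * ((1 - X ^ n) * X ^ s - (1 + X ^ n)) =
    shanksCoeff K m * (1 - X ^ m) * (X ^ n) ^ m := by
  induction m with
  | zero => simp
  | succ m ih =>
    rw [Finset.sum_range_succ, ih, shanksCoeff_succ_mul]
    ring

/-- Shanks' finite form of Gauss' product formula for `φ(-q)`. -/
theorem shanks_identity (n : ℕ) :
    gaussProd K n * ∑ s ∈ Finset.range (n + 1), shanksCoeff K s * (X ^ (n + 1)) ^ s =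
      1 + ∑ i ∈ Finset.range n, 2 * (-1) ^ (i + 1) * X ^ ((i + 1) ^ 2) := by
  induction n with
  | zero => simp [gaussProd, shanksCoeff]
  | succ n ih =>
    rw [Finset.sum_range_succ _ n, ← add_assoc, ← ih, ← gaussProd_mul_shanksCoeff,
      gaussProd_succ]
    have h1 := gaussFactor_mul (K := K) n.succ_ne_zero
    rw [Nat.succ_eq_add_one] at h1
    have h2 := shanks_telescope (K := K) (n + 1) (n + 1)
    have h3 : ∑ s ∈ Finset.range (n + 1), shanksCoeff K s * (X ^ (n + 1)) ^ s *
          ((1 - X ^ (n + 1)) * X ^ s - (1 + X ^ (n + 1))) =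
        (1 - X ^ (n + 1)) * ∑ s ∈ Finset.range (n + 1), shanksCoeff K s * (X ^ (n + 1 + 1)) ^ s -
        (1 + X ^ (n + 1)) * ∑ s ∈ Finset.range (n + 1), shanksCoeff K s * (X ^ (n + 1)) ^ s := by
      rw [Finset.mul_sum, Finset.mul_sum, ← Finset.sum_sub_distrib]
      refine Finset.sum_congr rfl fun s _ => ?_
      rw [pow_succ X (n + 1), mul_pow]
      ring
    rw [h3] at h2
    have hne : (1 + X ^ (n + 1) : K⟦X⟧) ≠ 0 := left_ne_zero_of_mul_eq_one
      (one_add_X_pow_mul_inv n.succ_ne_zero)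
    rw [Finset.sum_range_succ _ (n + 1)]
    refine mul_right_cancel₀ hne ?_
    have h4 : (X ^ (n + 1 + 1) : K⟦X⟧) ^ (n + 1) = X ^ (n + 1) ^ 2 * X ^ (n + 1) := by ring
    have h5 : (X ^ (n + 1) : K⟦X⟧) ^ (n + 1) = X ^ (n + 1) ^ 2 := by ring
    rw [h4]
    rw [h5] at h2
    linear_combination gaussProd K n * h2 + gaussProd K n *
      (∑ s ∈ Finset.range (n + 1), shanksCoeff K s * (X ^ (n + 1 + 1)) ^ s +
        shanksCoeff K (n + 1) * X ^ (n + 1) ^ 2 * X ^ (n + 1) -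
        (1 + X ^ (n + 1)) * shanksCoeff K (n + 1) * X ^ (n + 1) ^ 2) * h1

theorem X_pow_dvd_gaussProd_sub (n : ℕ) :
    (X : K⟦X⟧) ^ (n + 1) ∣ gaussProd K n - phiNeg.map (Int.castRingHom K) := by
  have h1 : (X : K⟦X⟧) ^ (n + 1) ∣ gaussProd K n -
      (1 + ∑ i ∈ Finset.range n, 2 * (-1) ^ (i + 1) * X ^ ((i + 1) ^ 2)) := by
    -- The term `s = 0` is `gaussProd K n` itself; all others carry a factor `X ^ (n + 1)`.
    rw [← shanks_identity, Finset.sum_range_succ', shanksCoeff, pow_zero, mul_one, mul_add, mul_one,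
      sub_add_cancel_right, dvd_neg]
    refine Dvd.dvd.mul_left (Finset.dvd_sum fun s _ => ?_) _
    rw [pow_succ _ s]
    exact ((dvd_mul_left _ _).mul_left _)
  have h2 : (X : K⟦X⟧) ^ (n + 1) ∣
      (1 + ∑ i ∈ Finset.range n, 2 * (-1) ^ (i + 1) * X ^ ((i + 1) ^ 2)) -
        phiNeg.map (Int.castRingHom K) := by
    rw [X_pow_dvd_iff]
    intro m hm
    have hc : ∀ i, coeff m (2 * (-1) ^ (i + 1) * X ^ ((i + 1) ^ 2) : K⟦X⟧) =
        if m = (i + 1) ^ 2 then 2 * (-1) ^ (i + 1) else 0 := by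
      intro i
      have h2 : (2 * (-1) ^ (i + 1) : K⟦X⟧) = C (2 * (-1) ^ (i + 1)) := by
        rw [map_mul, map_pow, map_neg, map_one, map_ofNat]
      rw [h2, coeff_C_mul, coeff_X_pow, mul_ite, mul_one, mul_zero]
    rw [map_sub, map_add, map_sum, coeff_map, coeff_phiNeg, coeff_one]
    simp only [hc]
    split_ifs with h0 hs
    · subst h0
      rw [Finset.sum_eq_zero fun i _ => if_neg (pow_ne_zero 2 i.succ_ne_zero).symm]
      simp
    · obtain ⟨r, rfl⟩ := hs
      have hr : r ≠ 0 := by rintro rfl; simp at h0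
      rw [Finset.sum_eq_single (r - 1)]
      · rw [Nat.sub_add_cancel (Nat.pos_of_ne_zero hr), if_pos (sq r).symm, pow_mul]
        rcases neg_one_pow_eq_or ℤ r with h | h <;> rcases Nat.even_or_odd r with hr | hr <;>
          simp [hr.neg_one_pow]
      · intro i _ hi
        refine if_neg fun h => hi ?_
        rw [← sq, Nat.pow_left_inj two_ne_zero] at h
        omega
      · intro h
        rw [Finset.mem_range] at h
        have := Nat.le_mul_self r
        omega
    · rw [Finset.sum_eq_zero fun i _ => if_neg fun h => hs ⟨i + 1, h.trans (sq _)⟩]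
      simp
  simpa using dvd_add h1 h2

/-- The product of the conjugates of a power series under `q ↦ ω q`, for a cube root of unity
`ω`. -/
noncomputable def cubicNorm (ω : K) (f : K⟦X⟧) : K⟦X⟧ :=
  f * rescale ω f * rescale (ω ^ 2) f

theorem cubicNorm_mul (ω : K) (f g : K⟦X⟧) :
    cubicNorm ω (f * g) = cubicNorm ω f * cubicNorm ω g := by
  simp only [cubicNorm, map_mul]
  ring

theorem rescale_gaussFactor_mul (ζ : K) {n : ℕ} (hn : n ≠ 0) :
    rescale ζ (gaussFactor K n) * (1 + C (ζ ^ n) * X ^ n) = 1 - C (ζ ^ n) * X ^ n := by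
  have h := congrArg (rescale ζ) (gaussFactor_mul (K := K) hn)
  simpa [mul_pow] using h

theorem eq_gaussFactor_of_mul {f : K⟦X⟧} {n : ℕ} (hn : n ≠ 0)
    (h : f * (1 + X ^ n) = 1 - X ^ n) : f = gaussFactor K n := by
  have hne : (1 + X ^ n : K⟦X⟧) ≠ 0 := left_ne_zero_of_mul_eq_one (one_add_X_pow_mul_inv hn)
  exact mul_right_cancel₀ hne (h.trans (gaussFactor_mul hn).symm)

theorem expand_gaussFactor (d : ℕ) (hd : d ≠ 0) {n : ℕ} (hn : n ≠ 0) :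
    expand d hd (gaussFactor K n) = gaussFactor K (d * n) := by
  refine eq_gaussFactor_of_mul (mul_ne_zero hd hn) ?_
  have h := congrArg (expand d hd) (gaussFactor_mul (K := K) hn)
  simpa [expand_X, pow_mul] using h

theorem cubicNorm_gaussFactor_of_dvd {ω : K} (hω : ω ^ 2 + ω + 1 = 0) {n : ℕ} (hn : n ≠ 0)
    (h3 : 3 ∣ n) : cubicNorm ω (gaussFactor K n) = gaussFactor K n ^ 3 := by
  have hω3 : ω ^ 3 = 1 := by linear_combination (ω - 1) * hω
  obtain ⟨m, rfl⟩ := h3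
  have h : ∀ ζ : K, ζ ^ 3 = 1 → rescale ζ (gaussFactor K (3 * m)) = gaussFactor K (3 * m) := by
    intro ζ hζ
    refine eq_gaussFactor_of_mul hn ?_
    simpa [pow_mul, hζ] using rescale_gaussFactor_mul ζ hn
  rw [cubicNorm, h ω hω3, h _ (by rw [← pow_mul, mul_comm, pow_mul, hω3, one_pow])]
  ring

theorem cubicNorm_gaussFactor_of_not_dvd {ω : K} (hω : ω ^ 2 + ω + 1 = 0) {n : ℕ}
    (h3 : ¬ 3 ∣ n) : cubicNorm ω (gaussFactor K n) = gaussFactor K (3 * n) := by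
  have hn : n ≠ 0 := by rintro rfl; simp at h3
  have hω3 : ω ^ 3 = 1 := by linear_combination (ω - 1) * hω
  obtain ⟨η, hη, h1, h2⟩ : ∃ η : K, η ^ 2 + η + 1 = 0 ∧ ω ^ n = η ∧ (ω ^ 2) ^ n = η ^ 2 := by
    refine ⟨ω ^ n, ?_, rfl, by rw [← pow_mul, ← pow_mul, mul_comm]⟩
    obtain ⟨m, rfl | rfl⟩ : ∃ m, n = 3 * m + 1 ∨ n = 3 * m + 2 := ⟨n / 3, by omega⟩
    · rw [pow_add, pow_mul, hω3]
      linear_combination hω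
    · rw [pow_add, pow_mul, hω3]
      linear_combination (ω ^ 2 - ω + 1) * hω
  have hη3 : (C η : K⟦X⟧) ^ 2 + C η + 1 = 0 := by
    rw [← map_pow, ← map_add, ← map_one C, ← map_add, hη, map_zero]
  refine eq_gaussFactor_of_mul (by omega) ?_
  have e0 := gaussFactor_mul (K := K) hn
  have e1 := rescale_gaussFactor_mul ω hn
  have e2 := rescale_gaussFactor_mul (ω ^ 2) hn
  rw [h1] at e1
  rw [h2, map_pow] at e2
  have p1 : (1 + X ^ n) * (1 + C η * X ^ n) * (1 + C η ^ 2 * X ^ n) = (1 + X ^ (3 * n) : K⟦X⟧) := by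
    rw [mul_comm 3, pow_mul]
    linear_combination (X ^ n + (X ^ n) ^ 2 * C η + (X ^ n) ^ 3 * (C η - 1)) * hη3
  have p2 : (1 - X ^ n) * (1 - C η * X ^ n) * (1 - C η ^ 2 * X ^ n) = (1 - X ^ (3 * n) : K⟦X⟧) := by
    rw [mul_comm 3, pow_mul]
    linear_combination (-X ^ n + (X ^ n) ^ 2 * C η - (X ^ n) ^ 3 * (C η - 1)) * hη3
  rw [← p1, ← p2, ← e0, ← e1, ← e2, cubicNorm]
  ring

/-- The norm of a factor depends on whether `3` divides its index, so the induction adds three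
consecutive factors at a time. -/
theorem cubicNorm_gaussProd {ω : K} (hω : ω ^ 2 + ω + 1 = 0) (n : ℕ) :
    cubicNorm ω (gaussProd K (3 * n)) * expand 9 (by norm_num) (gaussProd K n) =
      expand 3 three_ne_zero (gaussProd K (3 * n)) * expand 3 three_ne_zero (gaussProd K n) ^ 3 := by
  induction n with
  | zero => simp [gaussProd, cubicNorm]
  | succ n ih =>
    rw [show 3 * (n + 1) = 3 * n + 1 + 1 + 1 by ring]
    simp only [gaussProd_succ, cubicNorm_mul, map_mul]
    rw [cubicNorm_gaussFactor_of_not_dvd hω (n := 3 * n + 1) (by omega),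
      cubicNorm_gaussFactor_of_not_dvd hω (n := 3 * n + 1 + 1) (by omega),
      cubicNorm_gaussFactor_of_dvd hω (n := 3 * n + 1 + 1 + 1) (by omega) (by omega)]
    simp only [expand_gaussFactor _ _ (Nat.succ_ne_zero _)]
    rw [show 9 * (n + 1) = 3 * (3 * n + 1 + 1 + 1) by ring,
      show 3 * (n + 1) = 3 * n + 1 + 1 + 1 by ring]
    linear_combination gaussFactor K (3 * (3 * n + 1)) * gaussFactor K (3 * (3 * n + 1 + 1)) *
      gaussFactor K (3 * (3 * n + 1 + 1 + 1)) * gaussFactor K (3 * n + 1 + 1 + 1) ^ 3 * ih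

theorem eq_of_forall_X_pow_dvd_sub {f g : K⟦X⟧} (h : ∀ n, X ^ (n + 1) ∣ f - g) : f = g := by
  ext n
  rw [← sub_eq_zero, ← map_sub]
  exact X_pow_dvd_iff.mp (h n) n n.lt_succ_self

theorem cubicNorm_phiNeg {ω : K} (hω : ω ^ 2 + ω + 1 = 0) :
    cubicNorm ω (phiNeg.map (Int.castRingHom K)) *
        expand 9 (by norm_num) (phiNeg.map (Int.castRingHom K)) =
      expand 3 three_ne_zero (phiNeg.map (Int.castRingHom K)) ^ 4 := by
  refine eq_of_forall_X_pow_dvd_sub fun n => ?_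
  let π := Ideal.Quotient.mk (Ideal.span {(X : K⟦X⟧) ^ (n + 1)})
  have hπ : ∀ {f g : K⟦X⟧}, π f = π g ↔ X ^ (n + 1) ∣ f - g := by
    intro f g
    rw [Ideal.Quotient.eq, Ideal.mem_span_singleton]
  have hdvd : ∀ m, n ≤ m → X ^ (n + 1) ∣ gaussProd K m - phiNeg.map (Int.castRingHom K) :=
    fun m hm => (pow_dvd_pow X (by omega)).trans (X_pow_dvd_gaussProd_sub m)
  -- Expansions and rescalings preserve congruences modulo `X ^ (n + 1)`, so the finite identity
  -- passes to the limit.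
  have hres : ∀ (σ : K⟦X⟧ →+* K⟦X⟧), X ∣ σ X → ∀ m, n ≤ m →
      π (σ (gaussProd K m)) = π (σ (phiNeg.map (Int.castRingHom K))) := by
    intro σ hσ m hm
    rw [hπ, ← map_sub]
    refine (pow_dvd_pow_of_dvd hσ (n + 1)).trans ?_
    rw [← map_pow]
    exact map_dvd σ (hdvd m hm)
  have hexp : ∀ (d : ℕ) (hd : d ≠ 0) (m : ℕ), n ≤ m → π (expand d hd (gaussProd K m)) =
      π (expand d hd (phiNeg.map (Int.castRingHom K))) := fun d hd =>
    hres (expand d hd : K⟦X⟧ →ₐ[K] K⟦X⟧) (by simpa [expand_X] using dvd_pow_self (X : K⟦X⟧) hd)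
  have hscale : ∀ ζ : K, π (rescale ζ (gaussProd K (3 * n))) =
      π (rescale ζ (phiNeg.map (Int.castRingHom K))) := fun ζ =>
    hres (rescale ζ) (by simp [rescale_X]) _ (by omega)
  rw [← hπ]
  have key := congrArg π (cubicNorm_gaussProd hω n)
  simp only [cubicNorm, map_mul, map_pow] at key ⊢
  rw [hscale, hscale, hπ.mpr (hdvd (3 * n) (by omega)), hexp _ _ _ le_rfl, hexp _ _ _ le_rfl,
    hexp _ _ (3 * n) (by omega)] at key
  rw [key]
  ring

end GaussProduct

theorem map_atPow (K : Type*) [Field K] (d : ℕ) [NeZero d] (f : ℤ⟦X⟧) :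
    (atPow d f).map (Int.castRingHom K) = expand d (NeZero.ne d) (f.map (Int.castRingHom K)) := by
  rw [atPow, map_expand]

/-- Put `a = φ(-q)`, `A = φ(-q⁹)`, `s = a - A`. As `s` has only exponents `1` modulo `3`, the
conjugates of `a` are `A + ωⁱ s`, with product `A³ + s³ = a (3A² - 3Aa + a²)`; `cubicNorm_phiNeg`
evaluates this product. -/
theorem theta_identity :
    phiNeg * atPow 9 phiNeg *
        (3 * atPow 9 phiNeg ^ 2 - 3 * atPow 9 phiNeg * phiNeg + phiNeg ^ 2) =
      atPow 3 phiNeg ^ 4 := by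
  refine PowerSeries.map_injective (Int.castRingHom ℂ) Int.cast_injective ?_
  obtain ⟨ω, hω⟩ : ∃ ω : ℂ, ω ^ 2 + ω + 1 = 0 := by
    obtain ⟨ω, h⟩ := exists_quadratic_eq_zero (a := (1 : ℂ)) (b := 1) (c := 1) one_ne_zero
      (IsAlgClosed.exists_eq_mul_self _)
    exact ⟨ω, by linear_combination h⟩
  have hω3 : ω ^ 3 = 1 := by linear_combination (ω - 1) * hω
  have key := cubicNorm_phiNeg hω
  have h9 := map_atPow ℂ 9 phiNeg
  rw [← map_atPow ℂ 3, ← h9] at key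
  have hA : ∀ ζ : ℂ, ζ ^ 3 = 1 → rescale ζ ((atPow 9 phiNeg).map (Int.castRingHom ℂ)) =
      (atPow 9 phiNeg).map (Int.castRingHom ℂ) := by
    intro ζ hζ
    ext n
    rw [coeff_rescale, coeff_map]
    by_cases h : 9 ∣ n
    · obtain ⟨m, rfl⟩ := (by norm_num : 3 ∣ 9).trans h
      rw [pow_mul, hζ, one_pow, one_mul]
    · rw [coeff_atPow_of_not_dvd 9 _ h, map_zero, mul_zero]
  have hs : ∀ ζ : ℂ, ζ ^ 3 = 1 →
      rescale ζ ((phiNeg - atPow 9 phiNeg).map (Int.castRingHom ℂ)) =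
        C ζ * (phiNeg - atPow 9 phiNeg).map (Int.castRingHom ℂ) := by
    intro ζ hζ
    ext n
    rw [coeff_rescale, coeff_C_mul, coeff_map]
    by_cases h : n % 3 = 1
    · rw [← Nat.div_add_mod n 3, h, pow_succ, pow_mul, hζ, one_pow, one_mul]
    · rw [coeff_phiNeg_sub_atPow n h, map_zero, mul_zero, mul_zero]
  have ha : ∀ ζ : ℂ, ζ ^ 3 = 1 → rescale ζ (phiNeg.map (Int.castRingHom ℂ)) =
      (atPow 9 phiNeg).map (Int.castRingHom ℂ) + C ζ * (phiNeg.map (Int.castRingHom ℂ) -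
        (atPow 9 phiNeg).map (Int.castRingHom ℂ)) := by
    intro ζ hζ
    have h1 := hs ζ hζ
    rw [map_sub, map_sub, hA ζ hζ] at h1
    rw [← h1]
    ring
  rw [cubicNorm, ha ω hω3, ha (ω ^ 2) (by linear_combination (ω ^ 3 + 1) * hω3)] at key
  simp only [map_mul, map_add, map_sub, map_pow, map_ofNat] at key ⊢
  have hC : (C ω : ℂ⟦X⟧) ^ 2 + C ω + 1 = 0 := by
    rw [← map_pow, ← map_add, ← map_one C, ← map_add, hω, map_zero]
  rw [← key]
  generalize phiNeg.map (Int.castRingHom ℂ) = a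
  generalize (atPow 9 phiNeg).map (Int.castRingHom ℂ) = A
  linear_combination (-a * A) * (A * (a - A) + C ω * (a - A) ^ 2 - (a - A) ^ 2) * hC

end InternalCongruence

/-! ### The operator `U` on power series -/

namespace InternalCongruence

open PowerSeries

/-- The operator `∑ a(n) q ^ n ↦ ∑ a(3 n) q ^ n`. -/
noncomputable def huff : ℤ⟦X⟧ →+ ℤ⟦X⟧ where
  toFun f := mk fun n => coeff (3 * n) f
  map_zero' := by ext n; simp
  map_add' f g := by ext n; simp

theorem coeff_huff (f : ℤ⟦X⟧) (n : ℕ) : coeff n (huff f) = coeff (3 * n) f := by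
  simp [huff]

theorem coeff_iterate_huff (i : ℕ) (f : ℤ⟦X⟧) (n : ℕ) :
    coeff n (huff^[i] f) = coeff (3 ^ i * n) f := by
  induction i generalizing f with
  | zero => simp
  | succ i ih => rw [Function.iterate_succ_apply, ih, coeff_huff, ← mul_assoc, pow_succ']

theorem constantCoeff_huff (f : ℤ⟦X⟧) : constantCoeff (huff f) = constantCoeff f := by
  rw [← coeff_zero_eq_constantCoeff_apply, coeff_huff, mul_zero, coeff_zero_eq_constantCoeff_apply]

theorem huff_atPow_mul (f g : ℤ⟦X⟧) : huff (atPow 3 f * g) = f * huff g := by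
  ext n
  rw [coeff_huff, coeff_mul, coeff_mul]
  symm
  refine Finset.sum_of_injOn (fun x => (3 * x.1, 3 * x.2)) ?_ ?_ ?_ ?_
  · intro x _ y _ h
    simp only [Prod.mk.injEq] at h
    ext <;> omega
  · intro x hx
    simp only [Finset.mem_coe, Finset.HasAntidiagonal.mem_antidiagonal] at hx ⊢
    omega
  · intro x hx hx'
    rw [coeff_atPow_of_not_dvd, zero_mul]
    rintro ⟨y, hy⟩
    rw [Finset.HasAntidiagonal.mem_antidiagonal] at hx
    refine hx' ⟨(y, n - y), ?_, ?_⟩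
    · simp
      omega
    · ext <;> simp <;> omega
  · intro x _
    rw [coeff_atPow_mul, coeff_huff]

theorem huff_one : huff 1 = 1 := by
  ext n
  rw [coeff_huff, coeff_one, coeff_one]
  simp

theorem huff_atPow (f : ℤ⟦X⟧) : huff (atPow 3 f) = f := by
  simpa [huff_one] using huff_atPow_mul f 1

theorem huff_ofNat_mul (k : ℕ) [k.AtLeastTwo] (f : ℤ⟦X⟧) :
    huff ((OfNat.ofNat k : ℤ⟦X⟧) * f) = OfNat.ofNat k * huff f := by
  have h : atPow 3 (OfNat.ofNat k) = OfNat.ofNat k := map_ofNat (expand 3 three_ne_zero) k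
  rw [← huff_atPow_mul, h]

theorem atPow_mul (d : ℕ) [NeZero d] (f g : ℤ⟦X⟧) : atPow d (f * g) = atPow d f * atPow d g :=
  map_mul _ _ _

theorem atPow_pow (d : ℕ) [NeZero d] (f : ℤ⟦X⟧) (n : ℕ) : atPow d (f ^ n) = atPow d f ^ n :=
  map_pow _ _ _

theorem atPow_three_atPow_three (f : ℤ⟦X⟧) : atPow 3 (atPow 3 f) = atPow 9 f := by
  rw [atPow, atPow, atPow, ← expand_mul]

theorem ne_zero_of_constantCoeff {f : ℤ⟦X⟧} (h : constantCoeff f = 1) : f ≠ 0 := by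
  rintro rfl
  simp at h

theorem constantCoeff_atPow_phiNeg (d : ℕ) [NeZero d] : constantCoeff (atPow d phiNeg) = 1 := by
  rw [constantCoeff_atPow, constantCoeff_phiNeg]

theorem phiNeg_ne_zero : phiNeg ≠ 0 := ne_zero_of_constantCoeff constantCoeff_phiNeg

theorem atPow_phiNeg_ne_zero (d : ℕ) [NeZero d] : atPow d phiNeg ≠ 0 :=
  ne_zero_of_constantCoeff (constantCoeff_atPow_phiNeg d)

theorem F_ne_zero : F ≠ 0 := ne_zero_of_constantCoeff constantCoeff_F

theorem constantCoeff_atPow_F (d : ℕ) [NeZero d] : constantCoeff (atPow d F) = 1 := by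
  rw [constantCoeff_atPow, constantCoeff_F]

theorem atPow_F_ne_zero (d : ℕ) [NeZero d] : atPow d F ≠ 0 :=
  ne_zero_of_constantCoeff (constantCoeff_atPow_F d)

theorem F_mul_phiNeg : F * phiNeg = atPow 3 phiNeg :=
  quot_mul_cancel _ _ constantCoeff_phiNeg

theorem xi_mul_phiNeg : xi * phiNeg = atPow 9 phiNeg :=
  quot_mul_cancel _ _ constantCoeff_phiNeg

theorem atPow_F_mul : atPow 3 F * atPow 3 phiNeg = atPow 9 phiNeg := by
  rw [← atPow_three_atPow_three, ← atPow_mul, F_mul_phiNeg]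

theorem F_mul_atPow_F : F * atPow 3 F = xi := by
  refine mul_right_cancel₀ phiNeg_ne_zero ?_
  rw [xi_mul_phiNeg, mul_right_comm, F_mul_phiNeg, mul_comm, atPow_F_mul]

theorem constantCoeff_xi : constantCoeff xi = 1 := by
  rw [← F_mul_atPow_F, map_mul, constantCoeff_F, constantCoeff_atPow_F, one_mul]

/-- The inverse `φ(-q) / φ(-q ^ 9)` of `ξ`. -/
noncomputable def xiInv : ℤ⟦X⟧ := quot phiNeg (atPow 9 phiNeg)

theorem xiInv_mul : xiInv * atPow 9 phiNeg = phiNeg :=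
  quot_mul_cancel _ _ (constantCoeff_atPow_phiNeg 9)

theorem xi_mul_xiInv : xi * xiInv = 1 := by
  refine mul_right_cancel₀ (atPow_phiNeg_ne_zero 9) ?_
  rw [mul_assoc, xiInv_mul, xi_mul_phiNeg, one_mul]

theorem atPow_F_pow_four_mul : atPow 3 (F ^ 4) * (3 - 3 * xiInv + xiInv ^ 2) = xi := by
  have h1 : phiNeg * atPow 9 phiNeg *
      (3 * atPow 9 phiNeg ^ 2 - 3 * atPow 9 phiNeg * phiNeg + phiNeg ^ 2) * atPow 3 F ^ 4 =
      atPow 9 phiNeg ^ 4 := by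
    rw [theta_identity, ← mul_pow, mul_comm, atPow_F_mul]
  refine mul_right_cancel₀ (mul_ne_zero phiNeg_ne_zero
    (pow_ne_zero 3 (atPow_phiNeg_ne_zero 9))) ?_
  rw [atPow_pow]
  linear_combination h1 - atPow 9 phiNeg ^ 3 * xi_mul_phiNeg +
    atPow 3 F ^ 4 * phiNeg * atPow 9 phiNeg *
      (-3 * atPow 9 phiNeg + xiInv * atPow 9 phiNeg + phiNeg) * xiInv_mul

theorem huff_phiNeg_sub : huff (phiNeg - atPow 9 phiNeg) = 0 := by
  ext n
  rw [coeff_huff, coeff_phiNeg_sub_atPow _ (by omega), map_zero]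

theorem huff_phiNeg_sub_sq : huff ((phiNeg - atPow 9 phiNeg) ^ 2) = 0 := by
  ext n
  rw [coeff_huff, sq, coeff_mul, map_zero]
  refine Finset.sum_eq_zero fun x hx => ?_
  rw [Finset.HasAntidiagonal.mem_antidiagonal] at hx
  by_cases h : x.1 % 3 = 1
  · rw [coeff_phiNeg_sub_atPow x.2 (by omega), mul_zero]
  · rw [coeff_phiNeg_sub_atPow x.1 h, zero_mul]

theorem huff_xiInv : huff xiInv = 1 := by
  refine mul_left_cancel₀ (atPow_phiNeg_ne_zero 3) ?_
  rw [← huff_atPow_mul, atPow_three_atPow_three, mul_comm, xiInv_mul, mul_one,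
    ← sub_add_cancel phiNeg (atPow 9 phiNeg), map_add, huff_phiNeg_sub, zero_add,
    ← atPow_three_atPow_three, sub_add_cancel, huff_atPow]

/-- In `(A + s)²` the terms `2As` and `s²` have exponents `1` and `2` modulo `3`, so `U` keeps only
`A²`. -/
theorem huff_xiInv_sq : huff (xiInv ^ 2) = 1 := by
  refine mul_left_cancel₀ (pow_ne_zero 2 (atPow_phiNeg_ne_zero 3)) ?_
  have h : phiNeg ^ 2 = atPow 3 (atPow 3 phiNeg ^ 2) +
      (2 * (atPow 3 (atPow 3 phiNeg) * (phiNeg - atPow 9 phiNeg)) +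
        (phiNeg - atPow 9 phiNeg) ^ 2) := by
    rw [atPow_pow, atPow_three_atPow_three]
    ring
  rw [← huff_atPow_mul, atPow_pow, atPow_three_atPow_three, ← mul_pow, mul_comm, xiInv_mul, h,
    map_add, map_add, huff_atPow, huff_ofNat_mul, huff_atPow_mul, huff_phiNeg_sub,
    huff_phiNeg_sub_sq]
  simp

theorem xi_pow_succ (k : ℕ) : xi ^ (k + 3) =
    atPow 3 (F ^ 4) * (3 * xi ^ (k + 2) - 3 * xi ^ (k + 1) + xi ^ k) := by
  have h := xi_mul_xiInv
  rw [pow_succ xi (k + 2)]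
  nth_rewrite 2 [← atPow_F_pow_four_mul]
  linear_combination atPow 3 (F ^ 4) * xi ^ k * (-3 * xi + xi * xiInv + 1) * h

theorem huff_xi : huff xi = F ^ 4 := by
  rw [← atPow_F_pow_four_mul, huff_atPow_mul, map_add, map_sub, huff_ofNat_mul, huff_xiInv,
    huff_xiInv_sq, ← mul_one (3 : ℤ⟦X⟧), huff_ofNat_mul, huff_one]
  ring

theorem huff_xi_sq : huff (xi ^ 2) = 3 * (F ^ 4) ^ 2 - 2 * F ^ 4 := by
  have h : xi ^ 2 = atPow 3 (F ^ 4) * (3 * xi - 3 * 1 + xiInv) := by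
    rw [sq]
    nth_rewrite 1 [← atPow_F_pow_four_mul]
    linear_combination atPow 3 (F ^ 4) * (-3 + xiInv) * xi_mul_xiInv
  rw [h, huff_atPow_mul, map_add, map_sub, huff_ofNat_mul, huff_ofNat_mul, huff_xiInv, huff_one,
    huff_xi]
  ring

open Polynomial in
theorem huff_xi_pow (k : ℕ) : huff (xi ^ k) = aeval (F ^ 4) (huffPoly k) := by
  induction k using Nat.strong_induction_on with
  | _ k ih =>
    match k with
    | 0 => simp [huffPoly, huff_one]
    | 1 => simp [huffPoly, huff_xi]
    | 2 => simp [huffPoly, huff_xi_sq, map_ofNat]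
    | k + 3 =>
      rw [xi_pow_succ, huff_atPow_mul, map_add, map_sub, huff_ofNat_mul, huff_ofNat_mul,
        ih _ (by omega), ih _ (by omega), ih _ (by omega), huffPoly]
      simp [map_ofNat]

theorem aeval_xi_cubicPoly : Polynomial.aeval xi cubicPoly = 3 * xi ^ 2 - 3 * xi + 1 := by
  simp [cubicPoly, map_ofNat]

theorem F_cube : F ^ 3 = atPow 3 F * Polynomial.aeval xi cubicPoly := by
  refine mul_right_cancel₀ (pow_ne_zero 3 (atPow_F_ne_zero 3)) ?_
  rw [← mul_pow, F_mul_atPow_F, aeval_xi_cubicPoly]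
  have h := xi_pow_succ 0
  rw [atPow_pow] at h
  linear_combination h

theorem F_pow_four : F ^ 4 = xi * Polynomial.aeval xi cubicPoly := by
  rw [pow_succ, F_cube, ← F_mul_atPow_F]
  ring

/-- Applying `U` to `F(q) F(q³) = ξ` gives `F · U F = F⁴`. -/
theorem huff_F : huff F = F ^ 3 := by
  refine mul_left_cancel₀ F_ne_zero ?_
  rw [← huff_atPow_mul, mul_comm, F_mul_atPow_F, huff_xi]
  ring

theorem huff_F_pow (j : ℕ) : huff (F * (F ^ 4) ^ j) =
    atPow 3 F * Polynomial.aeval xi (cubicPoly * (huffQuot j).comp (Polynomial.X * cubicPoly)) := by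
  have h : huff (F * (F ^ 4) ^ j) = F ^ 3 * Polynomial.aeval (F ^ 4) (huffQuot j) := by
    -- Multiplication by `F ^ (4 * j + 1)` outside `U` is multiplication by `F(q³) ^ (4 * j + 1)`
    -- inside, producing `ξ ^ (4 * j + 1)`.
    refine mul_left_cancel₀ (pow_ne_zero (4 * j + 1) F_ne_zero) ?_
    rw [← huff_atPow_mul, atPow_pow, ← pow_mul, ← pow_succ', ← mul_pow, mul_comm, F_mul_atPow_F,
      huff_xi_pow, ← X_pow_mul_huffQuot, map_mul, map_pow, Polynomial.aeval_X]
    ring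
  rw [h, F_cube, F_pow_four, map_mul, Polynomial.aeval_comp, map_mul, Polynomial.aeval_X, mul_assoc]

theorem huff_atPow_F_mul_aeval (P : Polynomial ℤ) : huff (atPow 3 F * Polynomial.aeval xi P) =
    F * Polynomial.aeval (F ^ 4) (monomialLift huffPoly P) := by
  induction P using Polynomial.induction_on' with
  | add P Q hP hQ => rw [map_add, mul_add, map_add, hP, hQ, map_add, map_add, mul_add]
  | monomial k c =>
    rw [← Polynomial.smul_X_eq_monomial]
    simp only [map_zsmul, mul_smul_comm]
    rw [monomialLift_X_pow, map_pow, Polynomial.aeval_X, huff_atPow_mul, huff_xi_pow]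

theorem huff_F_mul_aeval (P : Polynomial ℤ) : huff (F * Polynomial.aeval (F ^ 4) P) =
    atPow 3 F * Polynomial.aeval xi
      (cubicPoly * (monomialLift huffQuot P).comp (Polynomial.X * cubicPoly)) := by
  induction P using Polynomial.induction_on' with
  | add P Q hP hQ =>
    rw [map_add, mul_add, map_add, hP, hQ, map_add, Polynomial.add_comp, ← mul_add, ← map_add,
      ← mul_add]
  | monomial k c =>
    rw [← Polynomial.smul_X_eq_monomial]
    simp only [map_zsmul, mul_smul_comm, Polynomial.smul_comp]
    rw [monomialLift_X_pow, map_pow, Polynomial.aeval_X, huff_F_pow]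

theorem huff_huff_atPow_F_mul (P : Polynomial ℤ) :
    huff (huff (atPow 3 F * Polynomial.aeval xi P)) =
      atPow 3 F * Polynomial.aeval xi (transfer P) := by
  rw [huff_atPow_F_mul_aeval, huff_F_mul_aeval, transfer, preTransfer_eq]

theorem iterate_huff_atPow_F_mul (i : ℕ) (P : Polynomial ℤ) :
    huff^[2 * i] (atPow 3 F * Polynomial.aeval xi P) =
      atPow 3 F * Polynomial.aeval xi (transfer^[i] P) := by
  induction i generalizing P with
  | zero => rfl
  | succ i ih =>
    rw [mul_add_one, Function.iterate_add_apply, Function.iterate_succ_apply transfer, ← ih,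
      ← huff_huff_atPow_F_mul]
    rfl

theorem constantCoeff_aeval_xi (P : Polynomial ℤ) :
    constantCoeff (Polynomial.aeval xi P) = P.eval 1 := by
  have h := Polynomial.hom_eval₂ P (algebraMap ℤ ℤ⟦X⟧) (constantCoeff (R := ℤ)) xi
  rw [constantCoeff_xi] at h
  rw [Polynomial.aeval_def, h, Polynomial.eval]
  congr 1

theorem eval_one_transfer (P : Polynomial ℤ) : (transfer P).eval 1 = P.eval 1 := by
  have h := congrArg constantCoeff (huff_huff_atPow_F_mul P)
  simpa [constantCoeff_huff, constantCoeff_aeval_xi, constantCoeff_atPow_F] using h.symm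

/-! ### The polynomials of `PhiHat` and their uniqueness -/

/-- The polynomial expressing `PhiHat (i + 1)` in terms of `ξ`. -/
noncomputable def phiHatPoly (i : ℕ) : Polynomial ℤ :=
  transfer^[i + 1] cubicPoly - transfer^[i] cubicPoly

theorem phiHatPoly_succ (i : ℕ) : phiHatPoly (i + 1) = transfer (phiHatPoly i) := by
  rw [phiHatPoly, phiHatPoly, transfer_sub, Function.iterate_succ_apply',
    ← Function.iterate_succ_apply' transfer i]

theorem eval_one_phiHatPoly (i : ℕ) : (phiHatPoly i).eval 1 = 0 := by
  rw [phiHatPoly, Function.iterate_succ_apply', Polynomial.eval_sub, eval_one_transfer, sub_self]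

theorem phiHatPoly_mem (i : ℕ) : phiHatPoly i ∈ valuationFilt (i + 3) := by
  induction i with
  | zero => simpa [phiHatPoly] using transfer_cubicPoly_sub_mem
  | succ i ih =>
    rw [phiHatPoly_succ, add_right_comm]
    exact transfer_mem ih (eval_one_phiHatPoly i)

theorem PhiHat_mul (m : ℕ) : PhiHat m * atPow 3 F =
    PowerSeries.mk fun n => ph3 (3 ^ (2 * m + 1) * n) - ph3 (3 ^ (2 * m - 1) * n) :=
  quot_mul_cancel _ _ (constantCoeff_atPow_F 3)

theorem PhiHat_succ_eq_aeval (i : ℕ) : PhiHat (i + 1) = Polynomial.aeval xi (phiHatPoly i) := by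
  refine mul_right_cancel₀ (atPow_F_ne_zero 3) ?_
  have h : ∀ k, huff^[2 * k + 1] F = atPow 3 F * Polynomial.aeval xi (transfer^[k] cubicPoly) := by
    intro k
    rw [Function.iterate_succ_apply, huff_F, F_cube, iterate_huff_atPow_F_mul]
  rw [PhiHat_mul, phiHatPoly, map_sub, mul_comm _ (atPow 3 F), mul_sub, ← h, ← h]
  ext n
  rw [coeff_mk, map_sub, coeff_iterate_huff, coeff_iterate_huff]
  rfl

theorem xi_ne_one : xi ≠ 1 := by
  intro h
  have h1 := xi_mul_phiNeg
  rw [h, one_mul] at h1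
  have h2 := congrArg (coeff 1) h1
  rw [coeff_phiNeg, coeff_atPow_of_not_dvd 9 _ (by norm_num)] at h2
  simp at h2

theorem aeval_injective_of_constantCoeff {f : ℤ⟦X⟧} (h0 : constantCoeff f = 0) (hf : f ≠ 0)
    (P : Polynomial ℤ) (hP : Polynomial.aeval f P = 0) : P = 0 := by
  induction hn : P.natDegree using Nat.strong_induction_on generalizing P with
  | _ n ih =>
    have hc : P.coeff 0 = 0 := by
      have h := congrArg constantCoeff hP
      rw [← Polynomial.X_mul_divX_add P] at h
      simpa [h0] using h
    have hX : P = Polynomial.X * P.divX := by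
      conv_lhs => rw [← Polynomial.X_mul_divX_add P, hc, map_zero, add_zero]
    rw [hX, map_mul, Polynomial.aeval_X, mul_eq_zero, or_iff_right hf] at hP
    by_cases hd : P.natDegree = 0
    · rw [Polynomial.eq_C_of_natDegree_eq_zero hd, hc, map_zero]
    · rw [hX, ih _ ?_ _ hP rfl, mul_zero]
      rw [Polynomial.natDegree_divX_eq_natDegree_tsub_one]
      omega

/-- Translation by `1` replaces `ξ` by `ξ - 1`, nonzero with zero constant term; a relation for such
a series loses a factor `X` repeatedly until it is zero. -/
theorem aeval_xi_injective : Function.Injective (Polynomial.aeval (R := ℤ) xi) := by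
  rw [injective_iff_map_eq_zero]
  intro P hP
  have h : P.comp (Polynomial.X + 1) = 0 := by
    refine aeval_injective_of_constantCoeff (f := xi - 1) ?_ (sub_ne_zero.mpr xi_ne_one) _ ?_
    · rw [map_sub, constantCoeff_xi, map_one, sub_self]
    · simpa [Polynomial.aeval_comp] using hP
  have h' := congrArg (fun Q => Q.comp (Polynomial.X - 1)) h
  simpa [Polynomial.comp_assoc] using h'

theorem dvd_coeff_aeval {c : ℤ} {P : Polynomial ℤ} (h : ∀ k, c ∣ P.coeff k) (f g : ℤ⟦X⟧) (n : ℕ) :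
    c ∣ coeff n (Polynomial.aeval f P * g) := by
  obtain ⟨Q, rfl⟩ := (Polynomial.C_dvd_iff_dvd_coeff c P).mpr h
  rw [← Polynomial.smul_eq_C_mul, map_zsmul, smul_mul_assoc, map_zsmul, smul_eq_mul]
  exact dvd_mul_right _ _

end InternalCongruence

theorem theorem4p3 (m : ℕ) (hm : 1 ≤ m) :
    (∃ P : Polynomial ℤ, InternalCongruence.PhiHat m =
      Polynomial.aeval InternalCongruence.xi P) ∧
    (∀ P : Polynomial ℤ, InternalCongruence.PhiHat m =
        Polynomial.aeval InternalCongruence.xi P →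
      ∀ k : ℕ, ((m + 2 + k / 2 : ℕ) : ℕ∞) ≤ InternalCongruence.nu (P.coeff k)) ∧
    (∀ n : ℕ, InternalCongruence.ph3 (3 ^ (2 * m + 1) * n) ≡
      InternalCongruence.ph3 (3 ^ (2 * m - 1) * n) [ZMOD 3 ^ (m + 2)]) := by
  obtain ⟨i, rfl⟩ : ∃ i, m = i + 1 := ⟨m - 1, by omega⟩
  have hmem := InternalCongruence.phiHatPoly_mem i
  refine ⟨⟨_, InternalCongruence.PhiHat_succ_eq_aeval i⟩, fun P hP k => ?_, fun n => ?_⟩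
  · rw [InternalCongruence.PhiHat_succ_eq_aeval] at hP
    rw [← InternalCongruence.aeval_xi_injective hP]
    exact le_emultiplicity_of_pow_dvd (hmem k)
  · have h := InternalCongruence.PhiHat_mul (i + 1)
    rw [InternalCongruence.PhiHat_succ_eq_aeval] at h
    have hd := InternalCongruence.dvd_coeff_aeval
      (fun k => (pow_dvd_pow 3 (Nat.le_add_right _ _)).trans (hmem k))
      InternalCongruence.xi (InternalCongruence.atPow 3 InternalCongruence.F) n
    rw [h, PowerSeries.coeff_mk] at hd
    exact (Int.modEq_iff_dvd.mpr hd).symm
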